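/- Let $k$ be an algebraically closed field of characteristic zero and let $d\ge 3$ be an integer. Put $$r=\left\lfloor \frac{\binom{d+3}{3}}{d+1}\right\rfloor,\quad q=\binom{d+3}{3}-r(d+1),\quad m=\left\lfloor \frac d3\right\rfloor+1,$$ $$s=\binom m2+(r-m)d-\binom{d+2}{3},\quad t=r-m-2s$$ (these are non-negative integers). Let $X''\subset\mathbb P^2_k$ be the generic union of a cone configuration of type $m$, that is, $m$ distinct lines $L_1,\dots,L_m$ through a common point $P$; of $s$ double points $2Q_1,\dots,2Q_s$, where $2Q$ is the subscheme with ideal sheaf $\mathcal I_Q^2$; of $t$ simple points $N_1,\dots,N_t$; and of $q$ points $P_1,\dots,P_q$ lying on a generic line $M$: $$X''=L_1+\cdots+L_m+2Q_1+\cdots+2Q_s+N_1+\cdots+N_t+P_1+\cdots+P_q\subset\mathbb P^2,$$ where $+$ denotes the schematic union (intersection of ideal sheaves). Then $$h^0(\mathbb P^2,\mathcal I_{X''}(d))=0.$$ Here "generic" means: in the space of all tuples $(P,L_1,\dots,L_m,Q_1,\dots,Q_s,N_1,\dots,N_t,M,P_1,\dots,P_q)$ with $P\in L_i$ for all $i$,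 the $L_i$ pairwise distinct, $P_l\in M$ for all $l$, and the points $Q_j,N_k,P_l$ pairwise distinct, the vanishing holds for every tuple in some nonempty dense Zariski open subset. -/

import Mathlib

open scoped LinearAlgebra.Projectivization Topology

/-- The (closed points of the) projective plane over `K`. By duality the same type parametrizes the
lines of the plane: `ℓ` stands for the line `{x | ℓ₀ x₀ + ℓ₁ x₁ + ℓ₂ x₂ = 0}`. -/
abbrev Plane (K : Type*) [Field K] : Type _ := ℙ K (Fin 3 → K)

namespace Plane

variable {K : Type*} [Field K]

/-- The set of points of the line with coefficient vector `ℓ`. -/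
def lineSet (ℓ : Plane K) : Set (Plane K) :=
  {x | Projectivization.orthogonal ℓ x}

/-- The affine cone over a set of points of the plane. -/
def affineCone (Z : Set (Plane K)) : Set (Fin 3 → K) :=
  {v | ∀ hv : v ≠ 0, Projectivization.mk K v hv ∈ Z}

/-- The homogeneous ideal of (the reduced closed subscheme supported on) a closed set `Z`. -/
noncomputable def idealOf (Z : Set (Plane K)) : Ideal (MvPolynomial (Fin 3) K) :=
  MvPolynomial.vanishingIdeal K (affineCone Z)

/-- `H⁰(ℙ², 𝓘(d))`, where `𝓘` is the ideal sheaf on `ℙ²` attached to the homogeneous ideal `I`: the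
forms `F` of degree `d` whose restriction to each standard chart `D₊(Xᵢ)` is a section of `𝓘(d)`,
that is, `F / Xᵢᵈ` lies in the degree-zero part of the localization of `I` at `Xᵢ`. -/
noncomputable def globalSections (I : Ideal (MvPolynomial (Fin 3) K)) (d : ℕ) :
    Submodule K (MvPolynomial (Fin 3) K) where
  carrier := {F | F.IsHomogeneous d ∧
    ∀ i : Fin 3, ∃ N : ℕ, (MvPolynomial.X i : MvPolynomial (Fin 3) K) ^ N * F ∈ I}
  zero_mem' := ⟨MvPolynomial.isHomogeneous_zero _ _ _, fun _ => ⟨0, by simp⟩⟩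
  add_mem' := by
    rintro F G ⟨hF, hF'⟩ ⟨hG, hG'⟩
    refine ⟨hF.add hG, fun i => ?_⟩
    obtain ⟨a, ha⟩ := hF' i
    obtain ⟨b, hb⟩ := hG' i
    refine ⟨a + b, ?_⟩
    have h := I.add_mem (I.mul_mem_left (MvPolynomial.X i ^ b) ha)
      (I.mul_mem_left (MvPolynomial.X i ^ a) hb)
    convert h using 1
    ring
  smul_mem' := by
    rintro c F ⟨hF, hF'⟩
    refine ⟨(MvPolynomial.homogeneousSubmodule (Fin 3) K d).smul_mem c hF, fun i => ?_⟩
    obtain ⟨a, ha⟩ := hF' i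
    refine ⟨a, ?_⟩
    rw [MvPolynomial.smul_eq_C_mul]
    have h := I.mul_mem_left (MvPolynomial.C c) ha
    convert h using 1
    ring

/-- `H⁰(ℙ², 𝓘(d))` is finite-dimensional, so that its `finrank` is its true dimension. -/
theorem finite_globalSections (I : Ideal (MvPolynomial (Fin 3) K)) (d : ℕ) :
    Module.Finite K (globalSections I d) := by
  have : Module.Finite K (MvPolynomial.homogeneousSubmodule (Fin 3) K d) :=
    Module.Finite.iff_fg.2 (MvPolynomial.homogeneousSubmodule_fg (R := K) (σ := Fin 3) d)
  exact Submodule.finiteDimensional_of_le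
    (S₂ := MvPolynomial.homogeneousSubmodule (Fin 3) K d) fun F hF => hF.1

/-- `h⁰(𝓘(d))`, the dimension of the space of global sections. -/
noncomputable def h0 (I : Ideal (MvPolynomial (Fin 3) K)) (d : ℕ) : ℕ :=
  Module.finrank K (globalSections I d)

/-- The Zariski topology on a product of copies of the projective plane, generated by the sets
`{x | f does not vanish identically on the tuples of homogeneous coordinates of x}`, where `f` is
a polynomial in all the homogeneous coordinates. -/
def zariski (K : Type*) [Field K] (ι : Type*) : TopologicalSpace (ι → Plane K) :=
  TopologicalSpace.generateFrom
    {U | ∃ f : MvPolynomial (ι × Fin 3) K,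
      U = {x | ∃ (v : ι → Fin 3 → K) (hv : ∀ i, v i ≠ 0),
        (∀ i, Projectivization.mk K (v i) (hv i) = x i) ∧
          MvPolynomial.eval (fun p => v p.1 p.2) f ≠ 0}}

/-- `p` holds for a generic member of the family `T` inside a product of planes: it holds on a
nonempty Zariski open subset of `T` that is dense in `T`. -/
def HoldsGenerically {ι : Type*} (T : Set (ι → Plane K)) (p : (ι → Plane K) → Prop) : Prop :=
  ∃ U : Set (ι → Plane K), IsOpen[zariski K ι] U ∧ (U ∩ T).Nonempty ∧
    T ⊆ closure[zariski K ι] (U ∩ T) ∧ ∀ x ∈ U ∩ T, p x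

/-- Labels for the points and lines that determine the scheme: the vertex `P` and the `m` lines
`Lᵢ` of the cone configuration, the supports `Qⱼ` of the `s` double points, the `t` simple points
`Nₖ`, the line `M`, and the `q` points `Pₗ` on `M`. -/
inductive Label (m s t q : ℕ) : Type
  | vertex : Label m s t q
  | coneLine (i : Fin m) : Label m s t q
  | double (j : Fin s) : Label m s t q
  | simple (k : Fin t) : Label m s t q
  | base : Label m s t q
  | collinear (l : Fin q) : Label m s t q

/-- The parameter space: `m` distinct lines through a vertex `P`, and `s + t + q` distinct points,
the last `q` of which lie on the line `M`. -/
structure IsConfiguration {m s t q : ℕ} (x : Label m s t q → Plane K) : Prop where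
  vertex_mem : ∀ i, x .vertex ∈ lineSet (x (.coneLine i))
  collinear_mem : ∀ l, x (.collinear l) ∈ lineSet (x .base)
  lines_distinct : Function.Injective fun i => x (.coneLine i)
  points_distinct : Function.Injective
    (Sum.elim (fun j => x (.double j))
      (Sum.elim (fun k => x (.simple k)) (fun l => x (.collinear l))))

/-- The ideal of the schematic union
`X'' = L₁ + ⋯ + Lₘ + 2Q₁ + ⋯ + 2Qₛ + N₁ + ⋯ + Nₜ + P₁ + ⋯ + P_q`: the intersection of the ideals
of the lines, of the squares of the ideals of the points `Qⱼ`, and of the ideals of the points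
`Nₖ` and `Pₗ`. -/
noncomputable def unionIdeal {m s t q : ℕ} (x : Label m s t q → Plane K) :
    Ideal (MvPolynomial (Fin 3) K) :=
  (⨅ i, idealOf (lineSet (x (.coneLine i)))) ⊓
  (⨅ j, idealOf {x (.double j)} ^ 2) ⊓
  (⨅ k, idealOf {x (.simple k)}) ⊓
  (⨅ l, idealOf {x (.collinear l)})

end Plane

/-! A form `F` of degree `d` vanishing on the `m` lines is the product of the `m` linear forms with
a form `G` of degree `n = d - m`. When no marked point lies on these lines, `G` is still singular at
the `Qⱼ` and zero at the `Nₖ` and `Pₗ`. Writing `d = 3(e + 1) + i` with `i < 3` gives `n = 2e + 1 +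
i`, and these `3s + t + q` conditions on `G` are exactly as many as the dimension of the space of
forms of degree `n`. It remains to see that they are independent for generic points.

Independence is shown at one special position. As `s` is at most the dimension of the forms of
degree `e`, there are points `Qⱼ` off the line `X₀ = 0` and forms `Aⱼ` of degree `e` with `Aⱼ(Qᵢ) =
δᵢⱼ`. The products of `Aⱼ²`, a power of `X₀` and a linear form realize every gradient at `Qⱼ` and
are singular at the other `Qᵢ`. If `q > 0`, the power of `X₀` is positive, so they also vanish at
the `Pₗ`, which are placed on `X₀ = 0`; thus the double points and the collinear points are
independent (`exists_jets_surjective`). The remaining `t`-dimensional space is killed by `t` simple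
points (`exists_config_no_forms`).

Independence is the nonvanishing of a determinant, hence an open condition
(`exists_principal_open`). Configurations have coordinates parametrized polynomially by an affine
space, so nonempty open conditions are dense among them (`holdsGenerically_of_affineGeneric`). -/

namespace Plane

open MvPolynomial Matrix

variable {K : Type*} [Field K]

/-! ### Linear forms and divisibility by the equations of lines -/

/-- The linear form with coefficient vector `ℓ`. -/
noncomputable def linForm (ℓ : Fin 3 → K) : MvPolynomial (Fin 3) K := ∑ c, C (ℓ c) * X c

@[simp]
theorem eval_linForm (ℓ w : Fin 3 → K) : eval w (linForm ℓ) = ℓ ⬝ᵥ w := by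
  simp [linForm, dotProduct]

theorem isHomogeneous_linForm (ℓ : Fin 3 → K) : (linForm ℓ).IsHomogeneous 1 :=
  IsHomogeneous.sum _ _ _ fun c _ => isHomogeneous_C_mul_X _ c

theorem coeff_linForm (ℓ : Fin 3 → K) (c : Fin 3) :
    (linForm ℓ).coeff (Finsupp.single c 1) = ℓ c := by
  simp [linForm, coeff_sum, coeff_C_mul, coeff_X, Finsupp.single_left_inj]

@[simp]
theorem pderiv_linForm (ℓ : Fin 3 → K) (c : Fin 3) : pderiv c (linForm ℓ) = C (ℓ c) := by
  simp [linForm, pderiv_X, Pi.single_apply]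

theorem linForm_ne_zero {ℓ : Fin 3 → K} (hℓ : ℓ ≠ 0) : linForm ℓ ≠ 0 := by
  contrapose! hℓ
  ext c
  rw [← coeff_linForm ℓ c, hℓ, coeff_zero, Pi.zero_apply]

theorem irreducible_linForm {ℓ : Fin 3 → K} (hℓ : ℓ ≠ 0) : Irreducible (linForm ℓ) := by
  refine irreducible_of_totalDegree_eq_one
    ((isHomogeneous_linForm ℓ).totalDegree (linForm_ne_zero hℓ)) fun x hx => ?_
  obtain ⟨c, hc⟩ := Function.ne_iff.1 hℓ
  refine isUnit_of_dvd_unit (hx (Finsupp.single c 1)) ?_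
  rw [coeff_linForm]
  exact isUnit_iff_ne_zero.2 hc

/-- The Nullstellensatz for the prime ideal generated by an irreducible linear form. -/
theorem linForm_dvd [IsAlgClosed K] {ℓ : Fin 3 → K} (hℓ : ℓ ≠ 0) {F : MvPolynomial (Fin 3) K}
    (hF : ∀ w, ℓ ⬝ᵥ w = 0 → eval w F = 0) : linForm ℓ ∣ F := by
  have hp : (Ideal.span {linForm ℓ}).IsPrime :=
    (Ideal.span_singleton_prime (linForm_ne_zero hℓ)).2 (irreducible_linForm hℓ).prime
  rw [← Ideal.mem_span_singleton, ← IsPrime.vanishingIdeal_zeroLocus (K := K)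
    (Ideal.span {linForm ℓ})]
  intro w hw
  rw [zeroLocus_span] at hw
  have := hw _ rfl
  rw [aeval_eq_eval, eval_linForm] at this
  rw [aeval_eq_eval]
  exact hF w this

theorem cross_eq_zero_of_linForm_dvd {ℓ ℓ' : Fin 3 → K} (h : linForm ℓ ∣ linForm ℓ') :
    ℓ' ⨯₃ ℓ = 0 := by
  obtain ⟨G, hG⟩ := h
  refine dotProduct_eq_zero _ fun u => ?_
  -- `ℓ` vanishes at `ℓ ⨯₃ u`, hence so does its multiple `ℓ'`; the triple product turns this into
  -- `u ⬝ᵥ (ℓ' ⨯₃ ℓ) = 0` for every `u`.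
  have := congrArg (eval (ℓ ⨯₃ u)) hG
  rw [eval_linForm, map_mul, eval_linForm, dot_self_cross, zero_mul,
    triple_product_permutation, triple_product_permutation] at this
  rwa [dotProduct_comm]

theorem prod_linForm_dvd [IsAlgClosed K] {ι : Type*} [Fintype ι] {ℓ : ι → Fin 3 → K}
    (hℓ : ∀ i, ℓ i ≠ 0) (hne : Pairwise fun i j => ℓ i ⨯₃ ℓ j ≠ 0)
    {F : MvPolynomial (Fin 3) K} (hF : ∀ i w, ℓ i ⬝ᵥ w = 0 → eval w F = 0) :
    ∏ i, linForm (ℓ i) ∣ F := by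
  refine Finset.prod_dvd_of_isRelPrime (fun i _ j _ hij => ?_)
    fun i _ => linForm_dvd (hℓ i) (hF i)
  rw [Function.onFun, (irreducible_linForm (hℓ i)).isRelPrime_iff_not_dvd]
  exact fun h => hne hij.symm (cross_eq_zero_of_linForm_dvd h)

attribute [local instance] MvPolynomial.gradedAlgebra in
theorem exists_isHomogeneous_of_dvd {P F : MvPolynomial (Fin 3) K} {a b : ℕ}
    (hP : P.IsHomogeneous a) (hF : F.IsHomogeneous (a + b)) (h : P ∣ F) :
    ∃ G : MvPolynomial (Fin 3) K, G.IsHomogeneous b ∧ F = P * G := by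
  obtain ⟨G, rfl⟩ := h
  -- The component of `P * G` in degree `a + b` is `P` times the component of `G` in degree `b`.
  -- Passing to the component also covers `P = 0`, where `G` is arbitrary.
  refine ⟨homogeneousComponent b G, homogeneousComponent_isHomogeneous b G, ?_⟩
  have h := DirectSum.coe_decompose_mul_add_of_left_mem
    (homogeneousSubmodule (Fin 3) K) (i := a) (j := b) (b := G) hP
  have h1 := decomposition.decompose'_apply (P * G) (a + b)
  have h2 := decomposition.decompose'_apply G b
  rw [homogeneousComponent_eq_self hF] at h1
  rw [← h2, ← h1]
  exact h

theorem exists_cross_eq {p w : Fin 3 → K} (hp : p ≠ 0) (h : p ⬝ᵥ w = 0) :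
    ∃ a, p ⨯₃ a = w := by
  obtain ⟨i, hi⟩ := Function.ne_iff.1 hp
  obtain ⟨u, hu⟩ : ∃ u : Fin 3 → K, p ⬝ᵥ u = 1 :=
    ⟨Pi.single i (p i)⁻¹, by rw [dotProduct_single]; exact mul_inv_cancel₀ hi⟩
  -- `p ⨯₃ (w ⨯₃ u) = (p ⬝ᵥ u) w - (p ⬝ᵥ w) u`, which is `w` here.
  refine ⟨w ⨯₃ u, ?_⟩
  rw [cross_cross_eq_smul_sub_smul', hu, dotProduct_comm w p, h]
  simp

/-! ### Pointwise conditions satisfied by global sections -/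

section Sections

variable {Z : Set (Plane K)} {F : MvPolynomial (Fin 3) K}

theorem eval_eq_zero_of_mem_idealOf {G : MvPolynomial (Fin 3) K} (h : G ∈ idealOf Z)
    {w : Fin 3 → K} (hw : w ≠ 0) (hZ : Projectivization.mk K w hw ∈ Z) : eval w G = 0 := by
  have := h w fun _ => hZ
  rwa [← coe_aeval_eq_eval]

theorem eval_eq_zero_of_locally_mem (h : ∀ i, ∃ N : ℕ, X i ^ N * F ∈ idealOf Z)
    {w : Fin 3 → K} (hw : w ≠ 0) (hZ : Projectivization.mk K w hw ∈ Z) : eval w F = 0 := by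
  obtain ⟨i, hi⟩ := Function.ne_iff.1 hw
  obtain ⟨N, hN⟩ := h i
  have := eval_eq_zero_of_mem_idealOf hN hw hZ
  rw [map_mul, map_pow, eval_X] at this
  exact (mul_eq_zero.1 this).resolve_left (pow_ne_zero _ hi)

theorem pderiv_mem_of_mem_sq {I : Ideal (MvPolynomial (Fin 3) K)} {G : MvPolynomial (Fin 3) K}
    (h : G ∈ I ^ 2) (c : Fin 3) : pderiv c G ∈ I := by
  rw [pow_two] at h
  refine Submodule.mul_induction_on h (fun a ha b hb => ?_) fun a b ha hb => ?_
  · rw [pderiv_mul]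
    exact I.add_mem (I.mul_mem_left _ hb) (I.mul_mem_right _ ha)
  · rw [map_add]
    exact I.add_mem ha hb

theorem eval_pderiv_eq_zero_of_locally_mem_sq
    (h : ∀ i, ∃ N : ℕ, X i ^ N * F ∈ idealOf Z ^ 2) {w : Fin 3 → K} (hw : w ≠ 0)
    (hZ : Projectivization.mk K w hw ∈ Z) (c : Fin 3) : eval w (pderiv c F) = 0 := by
  have h0 : eval w F = 0 := eval_eq_zero_of_locally_mem
    (fun i => (h i).imp fun N hN => Ideal.pow_le_self two_ne_zero hN) hw hZ
  obtain ⟨i, hi⟩ := Function.ne_iff.1 hw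
  obtain ⟨N, hN⟩ := h i
  have := eval_eq_zero_of_mem_idealOf (pderiv_mem_of_mem_sq hN c) hw hZ
  rw [pderiv_mul, map_add, map_mul, map_mul, h0, mul_zero, zero_add, map_pow, eval_X] at this
  exact (mul_eq_zero.1 this).resolve_left (pow_ne_zero _ hi)

end Sections

/-! ### A special position with independent conditions -/

theorem finrank_homogeneousSubmodule (n : ℕ) :
    Module.finrank K (homogeneousSubmodule (Fin 3) K n) = (n + 2).choose 2 := by
  have h : homogeneousSubmodule (Fin 3) K n = restrictSupport K {a | a.degree = n} :=
    homogeneousSubmodule_eq_finsupp_supported _ _ n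
  rw [h, Module.finrank_eq_nat_card_basis (basisRestrictSupport K {a | a.degree = n})]
  have hset : {a : Fin 3 →₀ ℕ | a.degree = n} =
      ((Finset.univ : Finset (Fin 3)).finsuppAntidiag n : Set (Fin 3 →₀ ℕ)) := by
    ext a
    simp [Finset.mem_finsuppAntidiag, Finsupp.degree_eq_sum]
  rw [hset, Nat.card_coe_set_eq, Set.ncard_coe_finset, Finset.card_finsuppAntidiag_nat_eq_choose,
    Finset.card_univ, Fintype.card_fin, show 3 + n - 1 = n + 2 by omega, ← Nat.choose_symm_add]

instance (n : ℕ) : FiniteDimensional K (homogeneousSubmodule (Fin 3) K n) :=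
  Module.Finite.iff_fg.2 (homogeneousSubmodule_fg (R := K) (σ := Fin 3) n)

/-- A space of functions of dimension at most `t` is determined by its values at `t` points. -/
theorem exists_points_of_finrank_le {V X : Type*} [AddCommGroup V] [Module K V] [Nonempty X]
    (ev : X → V →ₗ[K] K) (t : ℕ) : ∀ (W : Submodule K V) [FiniteDimensional K W],
    (∀ w ∈ W, (∀ x, ev x w = 0) → w = 0) → Module.finrank K W ≤ t →
      ∃ x : Fin t → X, ∀ w ∈ W, (∀ k, ev (x k) w = 0) → w = 0 := by
  induction t with
  | zero =>
    intro W _ _ ht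
    have : W = ⊥ := Submodule.finrank_eq_zero.1 (Nat.le_zero.1 ht)
    exact ⟨Fin.elim0, fun w hw _ => by simpa [this] using hw⟩
  | succ t ih =>
    intro W _ hinj ht
    by_cases hW : W = ⊥
    · exact ⟨fun _ => Classical.arbitrary X, fun w hw _ => by simpa [hW] using hw⟩
    obtain ⟨w, hw, hw0⟩ := W.ne_bot_iff.1 hW
    obtain ⟨x, hx⟩ : ∃ x, ev x w ≠ 0 := by
      by_contra! h
      exact hw0 (hinj w hw h)
    -- A point where some element of `W` is nonzero cuts the dimension down by at least one.
    have hlt : W ⊓ LinearMap.ker (ev x) < W :=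
      lt_of_le_of_ne inf_le_left fun h => hx (LinearMap.mem_ker.1 ((h.symm ▸ hw : _ ∈ W ⊓ _).2))
    have : FiniteDimensional K ↥(W ⊓ LinearMap.ker (ev x)) :=
      Submodule.finiteDimensional_of_le hlt.le
    obtain ⟨y, hy⟩ := ih (W ⊓ LinearMap.ker (ev x)) (fun v hv => hinj v hv.1)
      (by have := Submodule.finrank_lt_finrank_of_lt hlt; omega)
    refine ⟨Fin.cons x y, fun v hv h => hy v ⟨hv, ?_⟩ fun k => ?_⟩
    · simpa using h 0
    · simpa using h k.succ

/-- Evaluation at a vector, as a linear functional on polynomials. -/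
noncomputable def evalₗ (w : Fin 3 → K) : MvPolynomial (Fin 3) K →ₗ[K] K := (aeval w).toLinearMap

@[simp]
theorem evalₗ_apply (w : Fin 3 → K) (F : MvPolynomial (Fin 3) K) : evalₗ w F = eval w F := by
  rw [evalₗ, AlgHom.toLinearMap_apply, aeval_eq_eval]

/-- There are `(e + 2).choose 2` points off the line `X₀ = 0` imposing independent conditions on
forms of degree `e`. -/
theorem exists_dual_forms [Infinite K] {e s : ℕ} (hs : s ≤ (e + 2).choose 2) :
    ∃ (Q : Fin s → Fin 3 → K) (A : Fin s → MvPolynomial (Fin 3) K), (∀ j, Q j 0 ≠ 0) ∧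
      (∀ j, (A j).IsHomogeneous e) ∧
      ∀ i j, eval (Q i) (A j) = if i = j then 1 else 0 := by
  let ev : {v : Fin 3 → K // v 0 ≠ 0} → MvPolynomial (Fin 3) K →ₗ[K] K := fun v => evalₗ v.1
  have : Nonempty {v : Fin 3 → K // v 0 ≠ 0} := ⟨⟨1, one_ne_zero⟩⟩
  obtain ⟨x, hx⟩ := exists_points_of_finrank_le ev ((e + 2).choose 2)
    (homogeneousSubmodule (Fin 3) K e) (fun F _ h => by
      -- The factor `X 0` extends the vanishing of `F` off the line to all of `K³`.
      have : X 0 * F = 0 := MvPolynomial.funext fun v => by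
        by_cases hv : v 0 = 0
        · simp [hv]
        · have := h ⟨v, hv⟩
          simp only [ev, evalₗ_apply] at this
          simp [this]
      exact (mul_eq_zero.1 this).resolve_left (X_ne_zero 0))
    (finrank_homogeneousSubmodule e).le
  let L : homogeneousSubmodule (Fin 3) K e →ₗ[K] (Fin ((e + 2).choose 2) → K) :=
    LinearMap.pi fun k => (ev (x k)).comp (Submodule.subtype _)
  have hinj : Function.Injective L := by
    rw [← LinearMap.ker_eq_bot, LinearMap.ker_eq_bot']
    exact fun F hF => Subtype.ext (hx F.1 F.2 fun k => congrFun hF k)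
  have hsurj : Function.Surjective L :=
    (LinearMap.injective_iff_surjective_of_finrank_eq_finrank
      (by rw [finrank_homogeneousSubmodule, Module.finrank_fin_fun])).1 hinj
  choose B hB using fun k => hsurj (Pi.single k 1)
  refine ⟨fun j => (x (Fin.castLE hs j)).1, fun j => (B (Fin.castLE hs j)).1,
    fun j => (x _).2, fun j => (B _).2, fun i j => ?_⟩
  have := congrFun (hB (Fin.castLE hs j)) (Fin.castLE hs i)
  simpa [L, ev, Pi.single_apply] using this

theorem dotProduct_grad {F : MvPolynomial (Fin 3) K} {n : ℕ} (hF : F.IsHomogeneous n)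
    (w : Fin 3 → K) : w ⬝ᵥ (fun c => eval w (pderiv c F)) = n * eval w F := by
  have := congrArg (eval w) hF.sum_X_mul_pderiv
  simpa [dotProduct] using this

/-- Multiples of a form `H` with `H(w) ≠ 0` by linear forms attain all gradients at `w`. -/
theorem exists_grad_mul_linForm [CharZero K] {H : MvPolynomial (Fin 3) K} {n : ℕ}
    (hH : H.IsHomogeneous n) {w : Fin 3 → K} (hw : eval w H ≠ 0) (g : Fin 3 → K) :
    ∃ ℓ, ∀ c, eval w (pderiv c (H * linForm ℓ)) = g c := by
  let T : (Fin 3 → K) →ₗ[K] (Fin 3 → K) :=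
    { toFun := fun ℓ c => eval w (pderiv c (H * linForm ℓ))
      map_add' := fun a b => by
        ext c
        simp only [pderiv_mul, pderiv_linForm, map_add, map_mul, eval_linForm, eval_C,
          Pi.add_apply, add_dotProduct]
        ring
      map_smul' := fun a b => by
        ext c
        simp only [pderiv_mul, pderiv_linForm, map_add, map_mul, eval_linForm, eval_C,
          Pi.smul_apply, smul_dotProduct, smul_eq_mul, RingHom.id_apply]
        ring }
  have hT : Function.Injective T := by
    rw [← LinearMap.ker_eq_bot, LinearMap.ker_eq_bot']
    intro ℓ hℓ
    -- If the gradient vanishes, Euler's relation gives `(n + 1) H(w) ℓ(w) = 0`, so `ℓ(w) = 0`; the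
    -- gradient is then `H(w) ℓ`, whence `ℓ = 0`.
    have h1 := dotProduct_grad (hH.mul (isHomogeneous_linForm ℓ)) w
    have h2 : (fun c => eval w (pderiv c (H * linForm ℓ))) = 0 := hℓ
    rw [h2, dotProduct_zero, map_mul, eval_linForm] at h1
    have h3 : ℓ ⬝ᵥ w = 0 := by
      have hn : ((n + 1 : ℕ) : K) ≠ 0 := Nat.cast_ne_zero.2 n.succ_ne_zero
      exact (mul_eq_zero.1 ((mul_eq_zero.1 h1.symm).resolve_left hn)).resolve_left hw
    ext c
    have := congrFun h2 c
    simpa [pderiv_mul, h3, hw] using this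
  obtain ⟨ℓ, hℓ⟩ := LinearMap.injective_iff_surjective.1 hT g
  exact ⟨ℓ, fun c => congrFun hℓ c⟩

/-- Values of forms of degree `n` at the points `(0 : 1 : l)`, `l < q ≤ n + 1`, are arbitrary. -/
theorem exists_forms_on_line [CharZero K] {n q : ℕ} (hq : q ≤ n + 1) (l : Fin q) :
    ∃ F : MvPolynomial (Fin 3) K, F.IsHomogeneous n ∧
      ∀ l' : Fin q, eval ![0, 1, (l' : K)] F = 0 ↔ l' ≠ l := by
  -- Lines `X₂ = i X₁` through the other points; `X₁` is `1` at all the points and pads the degree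
  -- to `n`.
  refine ⟨X 1 ^ (n + 1 - q) * ∏ i ∈ Finset.univ.erase l, linForm ![0, -(i : K), 1], ?_,
    fun l' => ?_⟩
  · have h := ((isHomogeneous_X K (1 : Fin 3)).pow (n + 1 - q)).mul
      (IsHomogeneous.prod (Finset.univ.erase l) (fun i : Fin q => linForm ![0, -(i : K), 1])
        (fun _ => 1) fun i _ => isHomogeneous_linForm _)
    convert h using 1
    have := l.2
    simp
    omega
  · simp only [map_mul, map_pow, eval_X, map_prod, eval_linForm]
    simp [Finset.prod_eq_zero_iff, ← sub_eq_neg_add, sub_eq_zero, Fin.val_inj]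

/-- Gradients at the points `Q j` and values at the points `R l`. -/
noncomputable def jets {s q : ℕ} (Q : Fin s → Fin 3 → K) (R : Fin q → Fin 3 → K) :
    MvPolynomial (Fin 3) K →ₗ[K] (Fin s → Fin 3 → K) × (Fin q → K) :=
  (LinearMap.pi fun j => LinearMap.pi fun c => evalₗ (Q j) ∘ₗ (pderiv c).toLinearMap).prod
    (LinearMap.pi fun l => evalₗ (R l))

theorem jets_apply {s q : ℕ} (Q : Fin s → Fin 3 → K) (R : Fin q → Fin 3 → K)
    (F : MvPolynomial (Fin 3) K) :
    jets Q R F = (fun j c => eval (Q j) (pderiv c F), fun l => eval (R l) F) := by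
  ext <;> simp [jets]

theorem exists_jets_surjective [CharZero K] {n e s q : ℕ} (hs : s ≤ (e + 2).choose 2)
    (hn : 2 * e + 1 ≤ n) (hq : q = 0 ∨ 2 * e + 2 ≤ n ∧ q ≤ n + 1) :
    ∃ (Q : Fin s → Fin 3 → K) (R : Fin q → Fin 3 → K), (∀ l, R l 0 = 0) ∧
      (homogeneousSubmodule (Fin 3) K n).map (jets Q R) = ⊤ := by
  obtain ⟨Q, A, hQ, hA, hQA⟩ := exists_dual_forms (K := K) hs
  refine ⟨Q, fun l => ![0, 1, (l : K)], fun l => rfl, ?_⟩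
  set R : Fin q → Fin 3 → K := fun l => ![0, 1, (l : K)]
  set V := (homogeneousSubmodule (Fin 3) K n).map (jets Q R)
  have hgrad : ∀ j g, ((Pi.single j g, 0) : (Fin s → Fin 3 → K) × (Fin q → K)) ∈ V := by
    intro j g
    -- The square makes every multiple of `H` singular at the other `Q i`. The exponent leaves room
    -- for one linear factor, and is positive when there are points on `X₀ = 0`.
    set H := A j ^ 2 * X 0 ^ (n - (2 * e + 1)) with hH
    have hHhom : H.IsHomogeneous (n - 1) := by
      have := ((hA j).pow 2).mul ((isHomogeneous_X K (0 : Fin 3)).pow (n - (2 * e + 1)))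
      convert this using 1
      omega
    have hHQ : eval (Q j) H ≠ 0 := by simp [hH, hQA, hQ]
    obtain ⟨ℓ, hℓ⟩ := exists_grad_mul_linForm hHhom hHQ g
    refine ⟨H * linForm ℓ, ?_, ?_⟩
    · have := hHhom.mul (isHomogeneous_linForm ℓ)
      rwa [Nat.sub_add_cancel (by omega)] at this
    · rw [jets_apply]
      refine Prod.ext (funext fun i => ?_) (funext fun l => ?_)
      · by_cases hij : i = j
        · subst hij
          ext c
          simpa only [Pi.single_eq_same] using hℓ c
        · ext c
          simp [hij, hH, hQA]
      · rcases hq with rfl | hq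
        · exact l.elim0
        · have : n - (2 * e + 1) ≠ 0 := by omega
          simp [hH, R, this]
  have hfst : ∀ g, ((g, 0) : (Fin s → Fin 3 → K) × (Fin q → K)) ∈ V := by
    intro g
    have := V.sum_mem fun j (_ : j ∈ Finset.univ) => hgrad j (g j)
    convert this using 1
    refine Prod.ext ?_ ?_
    · simp [Prod.fst_sum, Finset.univ_sum_single]
    · simp [Prod.snd_sum]
  have hsnd : ∀ l, ((0, Pi.single l 1) : (Fin s → Fin 3 → K) × (Fin q → K)) ∈ V := by
    intro l
    have hqn : q ≤ n + 1 := by omega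
    obtain ⟨F, hF, hFl⟩ := exists_forms_on_line (K := K) hqn l
    have h1 : jets Q R F ∈ V := ⟨F, hF, rfl⟩
    -- The gradients of `F` at the `Q j` are removed by `hfst`, which leaves the values on the line
    -- unchanged.
    have h2 := V.smul_mem (eval (R l) F)⁻¹ (V.sub_mem h1 (hfst (jets Q R F).1))
    convert h2 using 1
    rw [jets_apply]
    refine Prod.ext (by simp) (funext fun l' => ?_)
    by_cases hl : l' = l
    · subst hl
      have : eval (R l') F ≠ 0 := fun h => (hFl l').1 h rfl
      simp [this]
    · have : eval (R l') F = 0 := (hFl l').2 hl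
      simp [this, hl]
  rw [eq_top_iff]
  rintro ⟨g, a⟩ -
  have h1 := V.add_mem (hfst g) (V.sum_mem fun l (_ : l ∈ Finset.univ) =>
    V.smul_mem (a l) (hsnd l))
  convert h1 using 1
  refine Prod.ext ?_ ?_
  · simp [Prod.fst_sum]
  · ext l
    simp [Prod.snd_sum, Pi.single_apply]

/-- Existence of `s` double points, `t` points and `q` points on the line `X₀ = 0` lying on no
curve of degree `n`. -/
theorem exists_config_no_forms [CharZero K] {n e s t q : ℕ} (hs : s ≤ (e + 2).choose 2)
    (hn : 2 * e + 1 ≤ n) (hq : q = 0 ∨ 2 * e + 2 ≤ n ∧ q ≤ n + 1)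
    (hcount : 3 * s + t + q = (n + 2).choose 2) :
    ∃ (Q : Fin s → Fin 3 → K) (N : Fin t → Fin 3 → K) (R : Fin q → Fin 3 → K),
      (∀ l, R l 0 = 0) ∧ ∀ G : MvPolynomial (Fin 3) K, G.IsHomogeneous n →
        (∀ j c, eval (Q j) (pderiv c G) = 0) → (∀ k, eval (N k) G = 0) →
        (∀ l, eval (R l) G = 0) → G = 0 := by
  obtain ⟨Q, R, hR, hsurj⟩ := exists_jets_surjective (K := K) hs hn hq
  let W := homogeneousSubmodule (Fin 3) K n
  let J := (jets Q R).domRestrict W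
  have hrange : LinearMap.range J = ⊤ := by
    rw [← hsurj, LinearMap.range_domRestrict]
  have hker : Module.finrank K (LinearMap.ker J) = t := by
    have h := J.finrank_range_add_finrank_ker
    rw [hrange, finrank_top, finrank_homogeneousSubmodule, Module.finrank_prod,
      Module.finrank_pi_fintype, Module.finrank_fin_fun] at h
    simp only [Module.finrank_fin_fun, Finset.sum_const, Finset.card_univ, Fintype.card_fin,
      smul_eq_mul] at h
    omega
  obtain ⟨N, hN⟩ := exists_points_of_finrank_le (K := K) evalₗ t
    ((LinearMap.ker J).map W.subtype)
    (fun G _ h => MvPolynomial.funext fun v => by rw [map_zero, ← evalₗ_apply, h v])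
    ((Submodule.finrank_map_subtype_eq W (LinearMap.ker J)).trans hker).le
  refine ⟨Q, N, R, hR, fun G hG h1 h2 h3 => hN G ⟨⟨G, hG⟩, ?_, rfl⟩ fun k => ?_⟩
  · rw [SetLike.mem_coe, LinearMap.mem_ker, LinearMap.domRestrict_apply, jets_apply]
    simp only [h1, h3]
    rfl
  · rw [evalₗ_apply, h2 k]

/-! ### Openness of independence -/

/-- If a family of conditions on a finite-dimensional space of polynomials, depending polynomially
on `v`, has no common solution at `v₀`, then it has none on a principal open neighbourhood. -/
theorem exists_principal_open {ι J : Type*} [Fintype J] (lab : J → ι)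
    (D : J → MvPolynomial (Fin 3) K →ₗ[K] MvPolynomial (Fin 3) K)
    (W : Submodule K (MvPolynomial (Fin 3) K)) [FiniteDimensional K W] (v₀ : ι → Fin 3 → K)
    (h₀ : ∀ G ∈ W, (∀ j, eval (v₀ (lab j)) (D j G) = 0) → G = 0) :
    ∃ g : MvPolynomial (ι × Fin 3) K, eval (fun p => v₀ p.1 p.2) g ≠ 0 ∧
      ∀ v : ι → Fin 3 → K, eval (fun p => v p.1 p.2) g ≠ 0 →
        ∀ G ∈ W, (∀ j, eval (v (lab j)) (D j G) = 0) → G = 0 := by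
  classical
  let b := Module.finBasis K W
  let A (v : ι → Fin 3 → K) : Matrix J (Fin (Module.finrank K W)) K :=
    Matrix.of fun j a => eval (v (lab j)) (D j (b a))
  let A' : Matrix J (Fin (Module.finrank K W)) (MvPolynomial (ι × Fin 3) K) :=
    Matrix.of fun j a => rename (fun i => (lab j, i)) (D j (b a))
  have hA' (v : ι → Fin 3 → K) : A'.map (eval fun p => v p.1 p.2) = A v := by
    ext j a
    simp [A, A', eval_rename, Function.comp_def]
  have hmul (v : ι → Fin 3 → K) (G : W) (j : J) :
      (A v *ᵥ b.repr G) j = eval (v (lab j)) (D j G) := by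
    have h := congrArg (evalₗ (v (lab j)) ∘ₗ D j ∘ₗ W.subtype) (b.sum_repr G)
    rw [map_sum] at h
    simpa [-Module.Basis.sum_repr, A, Matrix.mulVec, dotProduct, mul_comm] using h
  have hinj : LinearMap.ker (A v₀).toLin' = ⊥ := by
    rw [LinearMap.ker_eq_bot']
    intro x hx
    have hG := h₀ (b.equivFun.symm x) (Submodule.coe_mem _) fun j => by
      rw [← hmul]
      have : ⇑(b.repr (b.equivFun.symm x)) = x := b.equivFun.apply_symm_apply x
      rw [this]
      exact congrFun hx j
    exact b.equivFun.symm.map_eq_zero_iff.1 (Subtype.ext hG)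
  -- A left inverse `B` of the condition matrix at `v₀` stays fixed as `v` varies: `det (B * A v)`
  -- is polynomial in `v`, equals `1` at `v₀`, and forces injectivity of `A v` where it is nonzero.
  obtain ⟨B, hB⟩ := LinearMap.exists_leftInverse_of_injective _ hinj
  let B' := LinearMap.toMatrix' B
  have hB' : B' * A v₀ = 1 := by
    rw [← LinearMap.toMatrix'_toLin' (A v₀), ← LinearMap.toMatrix'_comp, hB,
      LinearMap.toMatrix'_id]
  let B'' : Matrix (Fin (Module.finrank K W)) J (MvPolynomial (ι × Fin 3) K) := B'.map C
  have hB'' (v : ι → Fin 3 → K) : B''.map (eval fun p => v p.1 p.2) = B' := by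
    ext
    simp [B'']
  have hdet (v : ι → Fin 3 → K) :
      eval (fun p => v p.1 p.2) (B'' * A').det = (B' * A v).det := by
    rw [RingHom.map_det, RingHom.mapMatrix_apply, Matrix.map_mul, hA', hB'']
  refine ⟨(B'' * A').det, ?_, fun v hv G hG h => ?_⟩
  · rw [hdet, hB', det_one]
    exact one_ne_zero
  · rw [hdet] at hv
    have hx : A v *ᵥ b.repr ⟨G, hG⟩ = 0 := by
      ext j
      rw [hmul, Pi.zero_apply]
      exact h j
    have := Matrix.eq_zero_of_mulVec_eq_zero hv (v := b.repr ⟨G, hG⟩)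
      (by rw [← Matrix.mulVec_mulVec, hx, Matrix.mulVec_zero])
    have h2 : b.repr ⟨G, hG⟩ = 0 := DFunLike.coe_injective this
    exact congrArg Subtype.val (b.repr.map_eq_zero_iff.1 h2)

/-! ### Generic properties on affine space -/

/-- `p` holds on a nonempty principal open subset of the affine space `K ^ σ`. -/
def AffineGeneric {σ : Type*} (p : (σ → K) → Prop) : Prop :=
  ∃ f : MvPolynomial σ K, f ≠ 0 ∧ ∀ z, eval z f ≠ 0 → p z

namespace AffineGeneric

variable {σ : Type*} {p p' : (σ → K) → Prop}

theorem of_eval_ne_zero (f : MvPolynomial σ K) {z₀ : σ → K} (h : eval z₀ f ≠ 0) :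
    AffineGeneric fun z => eval z f ≠ 0 :=
  ⟨f, fun hf => h (by rw [hf, map_zero]), fun _ => id⟩

theorem of_forall (h : ∀ z, p z) : AffineGeneric p := ⟨1, one_ne_zero, fun z _ => h z⟩

theorem mono (h : AffineGeneric p) (hp : ∀ z, p z → p' z) : AffineGeneric p' :=
  h.imp fun _ hf => ⟨hf.1, fun z hz => hp z (hf.2 z hz)⟩

theorem and (h : AffineGeneric p) (h' : AffineGeneric p') :
    AffineGeneric fun z => p z ∧ p' z := by
  obtain ⟨f, hf, hp⟩ := h
  obtain ⟨f', hf', hp'⟩ := h'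
  refine ⟨f * f', mul_ne_zero hf hf', fun z hz => ?_⟩
  rw [map_mul] at hz
  exact ⟨hp z (left_ne_zero_of_mul hz), hp' z (right_ne_zero_of_mul hz)⟩

theorem forall_fintype {α : Type*} [Fintype α] {p : α → (σ → K) → Prop}
    (h : ∀ a, AffineGeneric (p a)) : AffineGeneric fun z => ∀ a, p a z := by
  choose f hf hp using h
  refine ⟨∏ a, f a, Finset.prod_ne_zero_iff.2 fun a _ => hf a, fun z hz a => hp a z ?_⟩
  rw [map_prod] at hz
  exact Finset.prod_ne_zero_iff.1 hz a (Finset.mem_univ a)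

theorem exists_point [Infinite K] (h : AffineGeneric p) : ∃ z, p z := by
  obtain ⟨f, hf, hp⟩ := h
  by_contra! hn
  exact hf (MvPolynomial.funext fun z => by
    rw [map_zero]
    by_contra hz
    exact hn z (hp z hz))

end AffineGeneric

/-! ### Configurations as the image of an affine space -/

section Parametrization

variable {m s t q : ℕ}

/-- A polynomial parametrization of the homogeneous coordinates of configurations. -/
def param {R : Type*} [CommRing R] (z : Label m s t q × Fin 3 → R) : Label m s t q → Fin 3 → R
  | .vertex => fun c => z (.vertex, c)
  | .coneLine i => (fun c => z (.vertex, c)) ⨯₃ (fun c => z (.coneLine i, c))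
  | .double j => fun c => z (.double j, c)
  | .simple k => fun c => z (.simple k, c)
  | .base => fun c => z (.base, c)
  | .collinear l => (fun c => z (.base, c)) ⨯₃ (fun c => z (.collinear l, c))

theorem eval_param_X (z : Label m s t q × Fin 3 → K) (a : Label m s t q) (c : Fin 3) :
    eval z (param X a c) = param z a c := by
  cases a <;> fin_cases c <;> simp [param, cross_apply]

theorem exists_param_eq {v : Label m s t q → Fin 3 → K} (hP : v .vertex ≠ 0) (hM : v .base ≠ 0)
    (hL : ∀ i, v .vertex ⬝ᵥ v (.coneLine i) = 0) (hR : ∀ l, v .base ⬝ᵥ v (.collinear l) = 0) :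
    ∃ z, param z = v := by
  choose a ha using fun i => exists_cross_eq hP (hL i)
  choose b hb using fun l => exists_cross_eq hM (hR l)
  refine ⟨fun p => (match p.1 with
    | .coneLine i => a i
    | .collinear l => b l
    | x => v x : Fin 3 → K) p.2, funext fun x => ?_⟩
  cases x <;> simp [param, ha, hb]

/-- A single admissible `v` with `g(v) ≠ 0` shows that the pullback of `g` along `param` is a
nonzero polynomial. Only the vertex and the base need nonzero coordinates, so that cross products
with them fill their orthogonal planes. -/
theorem AffineGeneric.of_param (g : MvPolynomial (Label m s t q × Fin 3) K)
    {v : Label m s t q → Fin 3 → K} (hP : v .vertex ≠ 0) (hM : v .base ≠ 0)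
    (hL : ∀ i, v .vertex ⬝ᵥ v (.coneLine i) = 0) (hR : ∀ l, v .base ⬝ᵥ v (.collinear l) = 0)
    (hg : eval (fun p => v p.1 p.2) g ≠ 0) :
    AffineGeneric fun z : Label m s t q × Fin 3 → K =>
      eval (fun p => param z p.1 p.2) g ≠ 0 := by
  obtain ⟨z₀, rfl⟩ := exists_param_eq hP hM hL hR
  have h (z : Label m s t q × Fin 3 → K) :
      eval z (bind₁ (fun p : Label m s t q × Fin 3 => param X p.1 p.2) g) =
        eval (fun p => param z p.1 p.2) g := by
    rw [← coe_aeval_eq_eval, RingHom.coe_coe, aeval_bind₁, aeval_eq_eval]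
    simp only [aeval_eq_eval, eval_param_X]
  rw [← h z₀] at hg
  exact (AffineGeneric.of_eval_ne_zero _ hg).mono fun z hz => by rwa [h z] at hz

/-- A configuration of homogeneous coordinates whose vertex and base line are `(1 : 0 : 0)`. -/
def witness (u : Label m s t q → Fin 3 → K) : Label m s t q → Fin 3 → K
  | .vertex => ![1, 0, 0]
  | .base => ![1, 0, 0]
  | x => u x

theorem AffineGeneric.of_witness (g : MvPolynomial (Label m s t q × Fin 3) K)
    {u : Label m s t q → Fin 3 → K} (hL : ∀ i, u (.coneLine i) 0 = 0)
    (hR : ∀ l, u (.collinear l) 0 = 0) (hg : eval (fun p => witness u p.1 p.2) g ≠ 0) :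
    AffineGeneric fun z : Label m s t q × Fin 3 → K =>
      eval (fun p => param z p.1 p.2) g ≠ 0 := by
  have h0 : (![1, 0, 0] : Fin 3 → K) ≠ 0 := fun h => one_ne_zero (congrFun h 0)
  exact AffineGeneric.of_param g (v := witness u) h0 h0
    (fun i => by simp [witness, dotProduct, Fin.sum_univ_three, hL])
    (fun l => by simp [witness, dotProduct, Fin.sum_univ_three, hR]) hg

/-- The bilinear form `∑ xᵢ yᵢ` in the coordinates of two labels. -/
noncomputable def dotPoly (a b : Label m s t q) : MvPolynomial (Label m s t q × Fin 3) K :=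
  ∑ c, X (a, c) * X (b, c)

theorem eval_dotPoly (v : Label m s t q → Fin 3 → K) (a b : Label m s t q) :
    eval (fun p => v p.1 p.2) (dotPoly a b) = v a ⬝ᵥ v b := by
  simp [dotPoly, dotProduct]

/-- The labels of the points other than the vertex. -/
def pointLabel : Fin s ⊕ Fin t ⊕ Fin q → Label m s t q :=
  Sum.elim .double (Sum.elim .simple .collinear)

theorem pointLabel_injective : Function.Injective (pointLabel : _ → Label m s t q) := by
  rintro (a | a | a) (b | b | b) h <;> simp_all [pointLabel]

theorem witness_pointLabel (u : Label m s t q → Fin 3 → K) (a : Fin s ⊕ Fin t ⊕ Fin q) :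
    witness u (pointLabel a) = u (pointLabel a) := by
  rcases a with a | a | a <;> rfl

theorem affineGeneric_param_ne_zero (a : Label m s t q) :
    AffineGeneric fun z : Label m s t q × Fin 3 → K => param z a ≠ 0 := by
  obtain ⟨c, hc⟩ : ∃ c : Fin 3, witness (fun _ => ![0, 1, 0]) a c ≠ (0 : K) := by
    cases a <;> first | exact ⟨0, one_ne_zero⟩ | exact ⟨1, one_ne_zero⟩
  refine (AffineGeneric.of_witness (X (a, c)) (u := fun _ => ![0, 1, 0]) (fun _ => rfl)
    (fun _ => rfl) (by rwa [eval_X])).mono fun z hz h => hz ?_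
  rw [eval_X, h, Pi.zero_apply]

theorem affineGeneric_dot_ne_zero (i : Fin m) (a : Fin s ⊕ Fin t ⊕ Fin q) :
    AffineGeneric fun z : Label m s t q × Fin 3 → K =>
      param z (.coneLine i) ⬝ᵥ param z (pointLabel a) ≠ 0 := by
  refine (AffineGeneric.of_witness (dotPoly (.coneLine i) (pointLabel a))
    (u := fun _ => ![0, 1, 0]) (fun _ => rfl) (fun _ => rfl) ?_).mono fun z hz => ?_
  · rw [eval_dotPoly, witness_pointLabel]
    simp [witness]
  · rwa [eval_dotPoly] at hz

theorem affineGeneric_cross_ne_zero {a b : Label m s t q} (hab : a ≠ b)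
    (ha : ∀ u : Label m s t q → Fin 3 → K, witness u a = u a)
    (hb : ∀ u : Label m s t q → Fin 3 → K, witness u b = u b) :
    AffineGeneric fun z : Label m s t q × Fin 3 → K => param z a ⨯₃ param z b ≠ 0 := by
  classical
  refine (AffineGeneric.of_witness (X (a, 1) * X (b, 2) - X (a, 2) * X (b, 1))
    -- The polynomial is the first coordinate of the cross product, which is `1` when `a` sits at
    -- `(0, 1, 0)` and `b` at `(0, 0, 1)`.
    (u := Function.update (fun _ => ![0, 1, 0]) b ![0, 0, 1]) (fun i => ?_) (fun i => ?_)
    ?_).mono fun z hz h => hz ?_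
  · rw [Function.update_apply]
    split_ifs <;> rfl
  · rw [Function.update_apply]
    split_ifs <;> rfl
  · simp [ha, hb, hab]
  · simpa [cross_apply] using congrFun h 0

end Parametrization

/-! ### Homogeneous coordinates and transfer to the Zariski topology -/

section Lift

variable {ι : Type*}

/-- `v` is a tuple of homogeneous coordinates of `x`. -/
def IsLift (v : ι → Fin 3 → K) (x : ι → Plane K) : Prop :=
  ∃ hv : ∀ i, v i ≠ 0, ∀ i, Projectivization.mk K (v i) (hv i) = x i

variable {v : ι → Fin 3 → K} {x : ι → Plane K}

theorem IsLift.mem_lineSet_iff (h : IsLift v x) (i j : ι) :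
    x j ∈ lineSet (x i) ↔ v i ⬝ᵥ v j = 0 := by
  obtain ⟨hv, hx⟩ := h
  rw [lineSet, Set.mem_ofPred_eq, ← hx, ← hx, Projectivization.orthogonal_mk]

theorem IsLift.eq_iff (h : IsLift v x) (i j : ι) : x i = x j ↔ v i ⨯₃ v j = 0 := by
  obtain ⟨hv, hx⟩ := h
  rw [← hx, ← hx, Projectivization.mk_eq_mk_iff_crossProduct_eq_zero]

end Lift

variable {m s t q : ℕ}

/-- This is the source of density: an open set containing one configuration contains the image of
almost all parameters. It holds for principal open sets by `AffineGeneric.of_param` and passes to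
finite intersections and unions. -/
theorem affineGeneric_mem_of_isOpen {V : Set (Label m s t q → Plane K)}
    (hV : IsOpen[zariski K (Label m s t q)] V) {x : Label m s t q → Plane K}
    (hx : IsConfiguration x) (hxV : x ∈ V) :
    AffineGeneric fun z : Label m s t q × Fin 3 → K => ∀ y, IsLift (param z) y → y ∈ V := by
  change TopologicalSpace.GenerateOpen _ V at hV
  induction hV with
  | basic V hV =>
    obtain ⟨f, rfl⟩ := hV
    obtain ⟨v, hv, hvx, hf⟩ := hxV
    have hl : IsLift v x := ⟨hv, hvx⟩
    refine (AffineGeneric.of_param f (hv _) (hv _) (fun i => ?_) (fun l => ?_) hf).mono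
      fun z hz y hy => ⟨param z, hy.1, hy.2, hz⟩
    · rw [dotProduct_comm]
      exact (hl.mem_lineSet_iff _ _).1 (hx.vertex_mem i)
    · exact (hl.mem_lineSet_iff _ _).1 (hx.collinear_mem l)
  | univ => exact AffineGeneric.of_forall fun _ _ _ => trivial
  | inter V W _ _ hV hW =>
    exact ((hV hxV.1).and (hW hxV.2)).mono fun z hz y hy => ⟨hz.1 y hy, hz.2 y hy⟩
  | sUnion S _ hS =>
    obtain ⟨V, hVS, hxV⟩ := hxV
    exact (hS V hVS hxV).mono fun z hz y hy => ⟨V, hVS, hz y hy⟩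

theorem affineGeneric_isConfiguration :
    AffineGeneric fun z : Label m s t q × Fin 3 → K =>
      ∃ y, IsLift (param z) y ∧ IsConfiguration y := by
  have h1 := AffineGeneric.forall_fintype fun i : Fin m => AffineGeneric.forall_fintype
    fun j : {j : Fin m // i ≠ j} => affineGeneric_cross_ne_zero (K := K) (s := s) (t := t) (q := q)
      (a := .coneLine i) (b := .coneLine j.1) (by simpa using j.2) (fun _ => rfl) (fun _ => rfl)
  have h2 := AffineGeneric.forall_fintype fun a : Fin s ⊕ Fin t ⊕ Fin q =>
    AffineGeneric.forall_fintype fun b : {b : Fin s ⊕ Fin t ⊕ Fin q // a ≠ b} =>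
      affineGeneric_cross_ne_zero (K := K) (m := m) (pointLabel_injective.ne b.2)
        (fun u => witness_pointLabel u a) (fun u => witness_pointLabel u b.1)
  have h3 := (AffineGeneric.forall_fintype fun i : Fin m =>
    affineGeneric_param_ne_zero (K := K) (m := m) (s := s) (t := t) (q := q) (.coneLine i)).and
      ((affineGeneric_param_ne_zero .vertex).and (affineGeneric_param_ne_zero .base))
  have h4 := AffineGeneric.forall_fintype fun a : Fin s ⊕ Fin t ⊕ Fin q =>
    affineGeneric_param_ne_zero (K := K) (m := m) (pointLabel a)
  refine (h1.and (h2.and (h3.and h4))).mono fun z ⟨hL, hQ, ⟨hL0, hP0, hM0⟩, hQ0⟩ => ?_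
  have h0 : ∀ a, param z a ≠ 0
    | .vertex => hP0
    | .base => hM0
    | .coneLine i => hL0 i
    | .double j => hQ0 (.inl j)
    | .simple k => hQ0 (.inr (.inl k))
    | .collinear l => hQ0 (.inr (.inr l))
  have hy : IsLift (param z) fun a => Projectivization.mk K (param z a) (h0 a) :=
    ⟨h0, fun _ => rfl⟩
  refine ⟨_, hy, fun i => ?_, fun l => ?_, fun i j hij => ?_, fun a b hab => ?_⟩
  · rw [hy.mem_lineSet_iff, dotProduct_comm]
    exact dot_self_cross _ _
  · rw [hy.mem_lineSet_iff]
    exact dot_self_cross _ _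
  · by_contra hne
    exact hL i ⟨j, hne⟩ ((hy.eq_iff _ _).1 hij)
  · by_contra hne
    refine hQ a ⟨b, hne⟩ ((hy.eq_iff (pointLabel a) (pointLabel b)).1 ?_)
    rcases a with a | a | a <;> rcases b with b | b | b <;> exact hab

/-- A property which holds for all configurations with some homogeneous coordinates where a
polynomial `g` does not vanish is generic, once `g` is generically nonzero on coordinates of
configurations. -/
theorem holdsGenerically_of_affineGeneric [Infinite K]
    {p : (Label m s t q → Plane K) → Prop} (g : MvPolynomial (Label m s t q × Fin 3) K)
    (hg : AffineGeneric fun z : Label m s t q × Fin 3 → K =>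
      eval (fun p => param z p.1 p.2) g ≠ 0)
    (hp : ∀ x v, IsConfiguration x → IsLift v x → eval (fun p => v p.1 p.2) g ≠ 0 → p x) :
    HoldsGenerically {x : Label m s t q → Plane K | IsConfiguration x} p := by
  refine ⟨{x | ∃ (v : Label m s t q → Fin 3 → K) (hv : ∀ i, v i ≠ 0),
    (∀ i, Projectivization.mk K (v i) (hv i) = x i) ∧ eval (fun p => v p.1 p.2) g ≠ 0},
    TopologicalSpace.isOpen_generateFrom_of_mem ⟨g, rfl⟩, ?_, fun x hx => ?_, ?_⟩
  · obtain ⟨z, hz, y, hy, hyT⟩ := (hg.and affineGeneric_isConfiguration).exists_point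
    exact ⟨y, ⟨param z, hy.1, hy.2, hz⟩, hyT⟩
  · let _ := zariski K (Label m s t q)
    refine mem_closure_iff.2 fun V hV hxV => ?_
    obtain ⟨z, ⟨hz, y, hy, hyT⟩, hzV⟩ := ((hg.and affineGeneric_isConfiguration).and
      (affineGeneric_mem_of_isOpen hV hx hxV)).exists_point
    exact ⟨y, hzV y hy, ⟨param z, hy.1, hy.2, hz⟩, hyT⟩
  · rintro x ⟨⟨v, hv, hvx, hgv⟩, hxT⟩
    exact hp x v hxT ⟨hv, hvx⟩ hgv

/-! ### Removing the lines and vanishing of the residual form -/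

/-- No nonzero form of degree `n` is singular at the `Qⱼ` and vanishes at the `Nₖ` and `Pₗ`. -/
def NoForms (n : ℕ) (v : Label m s t q → Fin 3 → K) : Prop :=
  ∀ G : MvPolynomial (Fin 3) K, G.IsHomogeneous n →
    (∀ j c, eval (v (.double j)) (pderiv c G) = 0) → (∀ k, eval (v (.simple k)) G = 0) →
    (∀ l, eval (v (.collinear l)) G = 0) → G = 0

theorem exists_poly_noForms {n : ℕ} {v₀ : Label m s t q → Fin 3 → K} (h : NoForms n v₀) :
    ∃ g : MvPolynomial (Label m s t q × Fin 3) K, eval (fun p => v₀ p.1 p.2) g ≠ 0 ∧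
      ∀ v : Label m s t q → Fin 3 → K, eval (fun p => v p.1 p.2) g ≠ 0 → NoForms n v := by
  obtain ⟨g, hg, hgv⟩ := exists_principal_open
    (Sum.elim (fun p : Fin s × Fin 3 => Label.double p.1)
      (Sum.elim .simple .collinear) : _ → Label m s t q)
    (Sum.elim (fun p => (pderiv p.2).toLinearMap) fun _ => LinearMap.id)
    (homogeneousSubmodule (Fin 3) K n) v₀
    (fun G hG hj => h G hG (fun j c => hj (.inl (j, c))) (fun k => hj (.inr (.inl k)))
      fun l => hj (.inr (.inr l)))
  refine ⟨g, hg, fun v hv G hG h1 h2 h3 => hgv v hv G hG ?_⟩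
  rintro (⟨j, c⟩ | k | l)
  · exact h1 j c
  · exact h2 k
  · exact h3 l

theorem affineGeneric_prod_dot_ne_zero :
    AffineGeneric fun z : Label m s t q × Fin 3 → K => eval (fun p => param z p.1 p.2)
      (∏ i : Fin m, ∏ a : Fin s ⊕ Fin t ⊕ Fin q, dotPoly (.coneLine i) (pointLabel a)) ≠ 0 := by
  refine (AffineGeneric.forall_fintype fun i : Fin m => AffineGeneric.forall_fintype
    fun a : Fin s ⊕ Fin t ⊕ Fin q => affineGeneric_dot_ne_zero (K := K) i a).mono fun z hz => ?_
  simp only [map_prod]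
  refine Finset.prod_ne_zero_iff.2 fun i _ => Finset.prod_ne_zero_iff.2 fun a _ => ?_
  rw [eval_dotPoly]
  exact hz i a

theorem h0_eq_zero_of_noForms [IsAlgClosed K] [CharZero K] {n : ℕ} (hmn : m + n ≠ 0)
    {x : Label m s t q → Plane K} {v : Label m s t q → Fin 3 → K} (hx : IsConfiguration x)
    (hv : IsLift v x) (hdot : ∀ i a, v (.coneLine i) ⬝ᵥ v (pointLabel a) ≠ 0)
    (hno : NoForms n v) : h0 (unionIdeal x) (m + n) = 0 := by
  suffices globalSections (unionIdeal x) (m + n) = ⊥ by rw [h0, this, finrank_bot]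
  rw [eq_bot_iff]
  rintro F ⟨hF, hloc⟩
  have hlocal (I : Ideal (MvPolynomial (Fin 3) K)) (hI : unionIdeal x ≤ I) (i : Fin 3) :
      ∃ N : ℕ, X i ^ N * F ∈ I := (hloc i).imp fun N hN => hI hN
  have hline (i : Fin m) (w : Fin 3 → K) (hw : v (.coneLine i) ⬝ᵥ w = 0) : eval w F = 0 := by
    -- The origin represents no point of the plane; there Euler's relation in positive degree gives
    -- `F(0) = 0`.
    by_cases hw0 : w = 0
    · subst hw0
      have h := dotProduct_grad hF 0
      rw [zero_dotProduct] at h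
      exact (mul_eq_zero.1 h.symm).resolve_left (Nat.cast_ne_zero.2 hmn)
    · refine eval_eq_zero_of_locally_mem (Z := lineSet (x (.coneLine i)))
        (hlocal _ fun G hG => (Ideal.mem_iInf.1 hG.1.1.1) i) hw0 ?_
      rw [lineSet, Set.mem_ofPred_eq, ← hv.2, Projectivization.orthogonal_mk]
      exact hw
  have hdvd : ∏ i, linForm (v (.coneLine i)) ∣ F :=
    prod_linForm_dvd (fun i => hv.1 _) (fun i j hij h =>
      hij (hx.lines_distinct ((hv.eq_iff _ _).2 h))) hline
  have hprod : (∏ i : Fin m, linForm (v (.coneLine i))).IsHomogeneous m := by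
    simpa using IsHomogeneous.prod Finset.univ (fun i : Fin m => linForm (v (.coneLine i)))
      (fun _ => 1) fun i _ => isHomogeneous_linForm _
  obtain ⟨G, hG, rfl⟩ := exists_isHomogeneous_of_dvd hprod hF hdvd
  set L := ∏ i : Fin m, linForm (v (.coneLine i)) with hL
  have hL0 (a) : eval (v (pointLabel a)) L ≠ 0 := by
    rw [hL, map_prod]
    refine Finset.prod_ne_zero_iff.2 fun i _ => ?_
    rw [eval_linForm]
    exact hdot i a
  have hpoint (a : Fin s ⊕ Fin t ⊕ Fin q)
      (h : unionIdeal x ≤ idealOf {x (pointLabel a)}) : eval (v (pointLabel a)) G = 0 := by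
    have := eval_eq_zero_of_locally_mem (hlocal _ h) (hv.1 (pointLabel a)) (hv.2 _)
    rw [map_mul] at this
    exact (mul_eq_zero.1 this).resolve_left (hL0 a)
  have hsq (j : Fin s) : unionIdeal x ≤ idealOf {x (.double j)} ^ 2 :=
    fun G hG => (Ideal.mem_iInf.1 hG.1.1.2) j
  have hGzero : G = 0 := by
    refine hno G hG (fun j c => ?_)
      (fun k => hpoint (.inr (.inl k)) fun G hG => (Ideal.mem_iInf.1 hG.1.2) k)
      (fun l => hpoint (.inr (.inr l)) fun G hG => (Ideal.mem_iInf.1 hG.2) l)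
    have h1 := hpoint (.inl j) ((hsq j).trans (Ideal.pow_le_self two_ne_zero))
    have h2 := eval_pderiv_eq_zero_of_locally_mem_sq (hlocal _ (hsq j)) (hv.1 (.double j))
      (hv.2 _) c
    have h1' : eval (v (.double j)) G = 0 := h1
    -- Since `G` vanishes at `Q j`, the derivative of `L * G` there is `L(Q j)` times that of `G`.
    rw [pderiv_mul, map_add, map_mul, map_mul, h1', mul_zero, zero_add] at h2
    exact (mul_eq_zero.1 h2).resolve_left (hL0 (.inl j))
  rw [hGzero, mul_zero]
  exact Submodule.zero_mem _

theorem holdsGenerically_h0_eq_zero [IsAlgClosed K] [CharZero K] {n e : ℕ}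
    (hs : s ≤ (e + 2).choose 2) (hn : 2 * e + 1 ≤ n)
    (hq : q = 0 ∨ 2 * e + 2 ≤ n ∧ q ≤ n + 1) (hcount : 3 * s + t + q = (n + 2).choose 2) :
    HoldsGenerically {x : Label m s t q → Plane K | IsConfiguration x}
      (fun x => h0 (unionIdeal x) (m + n) = 0) := by
  obtain ⟨Q, N, R, hR, hno⟩ := exists_config_no_forms (K := K) hs hn hq hcount
  let u : Label m s t q → Fin 3 → K
    | .double j => Q j
    | .simple k => N k
    | .collinear l => R l
    -- The cone lines may have zero coordinates: `NoForms` does not involve them, and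
    -- `AffineGeneric.of_witness` allows it.
    | _ => 0
  obtain ⟨g, hg, hgv⟩ := exists_poly_noForms (v₀ := witness u) (n := n) hno
  have hgen := (AffineGeneric.of_witness g (fun _ => rfl) hR hg).and
    (affineGeneric_prod_dot_ne_zero (K := K) (m := m) (s := s) (t := t) (q := q))
  refine holdsGenerically_of_affineGeneric (g * ∏ i : Fin m, ∏ a : Fin s ⊕ Fin t ⊕ Fin q,
    dotPoly (.coneLine i) (pointLabel a)) (hgen.mono fun z hz => ?_) fun x v hx hv hz => ?_
  · rw [map_mul]
    exact mul_ne_zero hz.1 hz.2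
  · rw [map_mul] at hz
    refine h0_eq_zero_of_noForms (by omega) hx hv (fun i a => ?_) (hgv v (left_ne_zero_of_mul hz))
    have h := right_ne_zero_of_mul hz
    simp only [map_prod] at h
    have := Finset.prod_ne_zero_iff.1 (Finset.prod_ne_zero_iff.1 h i (Finset.mem_univ i)) a
      (Finset.mem_univ a)
    rwa [eval_dotPoly] at this

/-! ### Arithmetic of the numerical data -/

theorem six_mul_choose_three (n : ℕ) : 6 * (n + 3).choose 3 = (n + 3) * (n + 2) * (n + 1) := by
  have h := Nat.descFactorial_eq_factorial_mul_choose (n + 3) 3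
  simp only [Nat.descFactorial, Nat.factorial, Nat.sub_zero, Nat.succ_eq_add_one] at h
  rw [show n + 3 - 2 = n + 1 by omega, show n + 3 - 1 = n + 2 by omega] at h
  linarith

theorem two_mul_choose_two (n : ℕ) : 2 * (n + 2).choose 2 = (n + 2) * (n + 1) := by
  have h := Nat.descFactorial_eq_factorial_mul_choose (n + 2) 2
  simp only [Nat.descFactorial, Nat.factorial, Nat.sub_zero, Nat.succ_eq_add_one] at h
  rw [show n + 2 - 1 = n + 1 by omega] at h
  linarith

/-- The numerical data attached to `d = 3 (e + 1) + i`. -/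
theorem exists_residual_degree {d r q m s t : ℕ} (hd : 3 ≤ d)
    (hr : r = (d + 3).choose 3 / (d + 1))
    (hq : (q : ℤ) = ((d + 3).choose 3 : ℤ) - (r : ℤ) * ((d : ℤ) + 1))
    (hm : m = d / 3 + 1)
    (hs : (s : ℤ) = (m.choose 2 : ℤ) + ((r : ℤ) - (m : ℤ)) * (d : ℤ) - ((d + 2).choose 3 : ℤ))
    (ht : (t : ℤ) = (r : ℤ) - (m : ℤ) - 2 * (s : ℤ)) :
    ∃ n e : ℕ, d = m + n ∧ s ≤ (e + 2).choose 2 ∧ 2 * e + 1 ≤ n ∧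
      (q = 0 ∨ 2 * e + 2 ≤ n ∧ q ≤ n + 1) ∧ 3 * s + t + q = (n + 2).choose 2 := by
  obtain ⟨e, i, hi, rfl⟩ : ∃ e i : ℕ, i < 3 ∧ d = 3 * (e + 1) + i :=
    ⟨d / 3 - 1, d % 3, Nat.mod_lt _ (by norm_num), by omega⟩
  obtain rfl : m = e + 2 := by omega
  have hT := two_mul_choose_two e
  -- `T` is both `m.choose 2` and the dimension of the forms of degree `e`. For `i = 0, 1, 2` the
  -- values are `s = T - (e + 1), T, T` and `q = 0, 0, e + 2`.
  set T := (e + 2).choose 2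
  have h3 := six_mul_choose_three (3 * (e + 1) + i)
  have h3' := six_mul_choose_three (3 * e + 2 + i)
  rw [show 3 * e + 2 + i + 3 = 3 * (e + 1) + i + 2 by ring] at h3'
  have hrq (q' : ℕ) (hq' : q' < 3 * (e + 1) + i + 1) (h : (3 * (e + 1) + i + 3).choose 3 =
      q' + (3 * (e + 1) + i + 1) * (3 * T + (i + 1) * (e + 2))) :
      r = 3 * T + (i + 1) * (e + 2) ∧ q = q' := by
    have h1 : r = 3 * T + (i + 1) * (e + 2) := by
      rw [hr, h, Nat.add_mul_div_left _ _ (by omega), Nat.div_eq_of_lt hq', zero_add]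
    refine ⟨h1, ?_⟩
    rw [h1, h] at hq
    push_cast at hq
    zify
    linarith
  refine ⟨2 * e + 1 + i, e, by omega, ?_⟩
  have hn := two_mul_choose_two (2 * e + 1 + i)
  zify at hT h3 h3' hn
  have h6 {a b : ℤ} (h : 6 * a = 6 * b) : a = b := by omega
  interval_cases i
  · obtain ⟨rfl, rfl⟩ := hrq 0 (by omega) (by
      zify
      exact h6 (by push_cast at h3 ⊢; linear_combination h3 - 9 * (4 + 3 * (e : ℤ)) * hT))
    push_cast at hs ht h3' hn
    have hs' : (s : ℤ) = T - (e + 1) :=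
      h6 (by linear_combination 6 * hs - h3' + 9 * (3 * (e : ℤ) + 3) * hT)
    refine ⟨by omega, by omega, by omega, ?_⟩
    zify
    exact h6 (by linear_combination 6 * ht + 6 * hs' - 3 * hn + 12 * hT)
  · obtain ⟨rfl, rfl⟩ := hrq 0 (by omega) (by
      zify
      exact h6 (by push_cast at h3 ⊢; linear_combination h3 - 9 * (5 + 3 * (e : ℤ)) * hT))
    push_cast at hs ht h3' hn
    have hs' : (s : ℤ) = T :=
      h6 (by linear_combination 6 * hs - h3' + 9 * (3 * (e : ℤ) + 4) * hT)
    refine ⟨by omega, by omega, by omega, ?_⟩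
    zify
    exact h6 (by linear_combination 6 * ht + 6 * hs' - 3 * hn + 12 * hT)
  · obtain ⟨rfl, rfl⟩ := hrq (e + 2) (by omega) (by
      zify
      exact h6 (by push_cast at h3 ⊢; linear_combination h3 - 9 * (6 + 3 * (e : ℤ)) * hT))
    push_cast at hs ht h3' hn
    have hs' : (s : ℤ) = T :=
      h6 (by linear_combination 6 * hs - h3' + 9 * (3 * (e : ℤ) + 5) * hT)
    refine ⟨by omega, by omega, by omega, ?_⟩
    zify
    exact h6 (by linear_combination 6 * ht + 6 * hs' - 3 * hn + 12 * hT)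

end Plane

theorem mainTheorem6 {K : Type*} [Field K] [IsAlgClosed K] [CharZero K]
    (d : ℕ) (hd : 3 ≤ d) (r q m s t : ℕ)
    (hr : r = (d + 3).choose 3 / (d + 1))
    (hq : (q : ℤ) = ((d + 3).choose 3 : ℤ) - (r : ℤ) * ((d : ℤ) + 1))
    (hm : m = d / 3 + 1)
    (hs : (s : ℤ) = (m.choose 2 : ℤ) + ((r : ℤ) - (m : ℤ)) * (d : ℤ) - ((d + 2).choose 3 : ℤ))
    (ht : (t : ℤ) = (r : ℤ) - (m : ℤ) - 2 * (s : ℤ)) :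
    Plane.HoldsGenerically
      {x : Plane.Label m s t q → Plane K | Plane.IsConfiguration x}
      (fun x => Plane.h0 (Plane.unionIdeal x) d = 0) := by
  obtain ⟨n, e, rfl, hse, hn, hqn, hcount⟩ :=
    Plane.exists_residual_degree hd hr hq hm hs ht
  exact Plane.holdsGenerically_h0_eq_zero hse hn hqn hcount
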